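/- Let $\Gamma$ be a countably infinite discrete group acting continuously on a compact metrizable space $X$. Let $\mathcal M(X)$ be the space of Borel probability measures on $X$ with the weak$^*$-topology, on which $\Gamma$ acts continuously by push-forward, and for each positive integer $N$ let $\mathcal M_N(X)\subseteq \mathcal M(X)$ be the closed $\Gamma$-invariant subset of those $\mu$ whose support has at most $N$ points. For a continuous action of $\Gamma$ on a compact metrizable space $Y$, an integer $k\ge 1$ and subsets $A_1,\dots,A_k$ of $Y$, a set $F\subseteq\Gamma$ is called an independence set for $(A_1,\dots,A_k)$ if $\bigcap_{s\in J}s^{-1}A_{\sigma(s)}\neq\emptyset$ for every nonempty finite set $J\subseteq F$ and every map $\sigma\colon J\to\{1,\dots,k\}$. A tuple $(y_1,\dots,y_k)\in Y^k$ is called an IT-tuple if for every product neighborhood $U_1\times\cdots\times U_k$ of it in $Y^k$, the tuple $(U_1,\dots,U_k)$ has an infinite independence set. Denote by $\mathrm{IT}_k(Y)$ the set of IT-tuples of length $k$ in $Y$. Then for any positive integers $k, N_1,\dots,N_k$, setting $N=\prod_{j=1}^k N_j$, one has $$\bigl(\mathcal M_{N_1}(X)\times\cdots\times\mathcal M_{N_k}(X)\bigr)\cap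 \mathrm{IT}_k(\mathcal M(X))\subseteq \mathrm{IT}_k(\mathcal M_N(X)),$$ where $\mathrm{IT}_k(\mathcal M_N(X))$ is formed with respect to the restricted action of $\Gamma$ on $\mathcal M_N(X)$ and is regarded as a subset of $\mathcal M(X)^k$. -/

import Mathlib

open MeasureTheory Topology

noncomputable section

/-- `F ⊆ Γ` is an independence set for the tuple `A = (A₁, …, A_k)` of subsets of `Y`:
`⋂_{s ∈ J} s⁻¹ A_{σ(s)} ≠ ∅` for every nonempty finite `J ⊆ F` and every map `σ : J → [k]`.
Here `s⁻¹ A = {y | s y ∈ A}`. -/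
def IsIndependenceSet {Γ Y : Type*} [SMul Γ Y] {k : ℕ} (A : Fin k → Set Y) (F : Set Γ) : Prop :=
  ∀ J : Finset Γ, J.Nonempty → (J : Set Γ) ⊆ F → ∀ σ : J → Fin k,
    (⋂ s : J, (fun y : Y => (s : Γ) • y) ⁻¹' A (σ s)).Nonempty

/-- The set `IT_k(Y)` of IT-tuples of length `k` of an action of `Γ` on `Y`: those `x ∈ Y^k` such
that for every product neighborhood `U₁ × ⋯ × U_k` of `x`, the tuple `(U₁, …, U_k)` has an
infinite independence set. -/
def ITTuples (Γ Y : Type*) [SMul Γ Y] [TopologicalSpace Y] (k : ℕ) : Set (Fin k → Y) :=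
  {x | ∀ U : Fin k → Set Y, (∀ j, U j ∈ 𝓝 (x j)) →
    ∃ F : Set Γ, F.Infinite ∧ IsIndependenceSet U F}

section Action

variable {Γ X : Type*} [Group Γ] [MulAction Γ X] [TopologicalSpace X] [ContinuousConstSMul Γ X]
  [MeasurableSpace X] [BorelSpace X]

/-- The induced action of `Γ` on the Borel probability measures of `X`, by push-forward. Together
with Mathlib's topology of weak convergence on `ProbabilityMeasure X` (for compact `X` the
weak-* topology) this is the action of `Γ` on `M(X)`. -/
instance probabilityMeasureMulAction : MulAction Γ (ProbabilityMeasure X) where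
  smul g μ := μ.map (measurable_const_smul g).aemeasurable
  one_smul μ := by
    apply Subtype.ext
    change Measure.map (fun x : X => (1 : Γ) • x) (μ : Measure X) = (μ : Measure X)
    simp
  mul_smul g h μ := by
    apply Subtype.ext
    change Measure.map (fun x : X => (g * h) • x) (μ : Measure X) =
      Measure.map (fun x : X => g • x) (Measure.map (fun x : X => h • x) (μ : Measure X))
    rw [Measure.map_map (measurable_const_smul g) (measurable_const_smul h)]
    congr 1
    funext x
    exact mul_smul g h x

theorem coe_smul_probabilityMeasure (g : Γ) (μ : ProbabilityMeasure X) :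
    ((g • μ : ProbabilityMeasure X) : Measure X) =
      Measure.map (fun x : X => g • x) (μ : Measure X) := rfl

/-- `M_N(X)`: the Borel probability measures on `X` whose support has at most `N` points. -/
def finSuppMeasures (X : Type*) [TopologicalSpace X] [MeasurableSpace X] (N : ℕ) :
    Set (ProbabilityMeasure X) :=
  {μ | (μ : Measure X).support.encard ≤ N}

/-- `M_N(X)` is invariant under the action of `Γ`. -/
theorem smul_mem_finSuppMeasures (N : ℕ) (g : Γ) {μ : ProbabilityMeasure X}
    (hμ : μ ∈ finSuppMeasures X N) : g • μ ∈ finSuppMeasures X N := by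
  have key : ((g • μ : ProbabilityMeasure X) : Measure X).support ⊆
      (fun x : X => g • x) '' (μ : Measure X).support := by
    intro x hx
    refine ⟨g⁻¹ • x, ?_, smul_inv_smul g x⟩
    rw [Measure.mem_support_iff_forall] at hx ⊢
    intro U hU
    obtain ⟨V, hVU, hV, hxV⟩ := mem_nhds_iff.1 hU
    have hW : IsOpen ((fun y : X => g⁻¹ • y) ⁻¹' V) := hV.preimage (continuous_const_smul g⁻¹)
    have h := hx _ (hW.mem_nhds hxV)
    rw [coe_smul_probabilityMeasure,
      Measure.map_apply (measurable_const_smul g) hW.measurableSet] at h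
    refine h.trans_le (measure_mono ?_)
    intro y hy
    apply hVU
    simpa using hy
  exact ((Set.encard_le_encard key).trans (Set.encard_image_le _ _)).trans hμ

/-- The restriction of the action of `Γ` on `M(X)` to the invariant set `M_N(X)`. -/
instance finSuppMeasuresMulAction (N : ℕ) : MulAction Γ (finSuppMeasures X N) where
  smul g μ := ⟨g • (μ : ProbabilityMeasure X), smul_mem_finSuppMeasures N g μ.2⟩
  one_smul μ := Subtype.ext (one_smul Γ (μ : ProbabilityMeasure X))
  mul_smul g h μ := Subtype.ext (mul_smul g h (μ : ProbabilityMeasure X))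

end Action

end

/-!
Let `μ j` have atoms indexed by `L j`, and let `φ j l` be a tent function around the atom `l`.
Colour the points `s` of the independence set independently and uniformly by `σ s : Fin k`. The
independence set and compactness couple the colouring with a random point `x` in such a way that,
conditioned on `σ s = j`, the expectation of `φ j l (s • x)` is almost `μ j {l}`, for all `s`, `j`
and `l`.

Let `g j l s` be `φ j l (s • x)` conditioned on `σ s = j`, that is, multiplied by `k` times the
indicator of this event. Along an ultrafilter the `g j l s` converge weakly to some `f j l ≥ 0`.
Since the normalized indicators converge weakly to `1`, one has `∑ l, f j l ≤ 1`, and the integral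
of `f j l` is still almost `μ j {l}`. The weights `w i = ∫ ∏ j, f j (i j)`, for `i : ∀ j, L j`,
therefore almost form a coupling of the `μ j`.

When `w i > 0`, weak convergence lets one choose points `s` one after the other in such a way that
for every pattern `τ` some `y i` satisfies `φ (τ s) (i (τ s)) (s • y i) > 0` for all chosen `s`.
Doing this for all `i` at once yields an infinite set on which every pattern `τ` is realised by the
measure `∑ i, w i δ_{y i}`, up to a small missing mass, and its support has at most
`∏ j, card (L j)` points.
-/

open Filter ProbabilityTheory

section WeakCompactness

variable {𝕜 H ι : Type*} [RCLike 𝕜] [NormedAddCommGroup H] [InnerProductSpace 𝕜 H]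
  [CompleteSpace H] {v : ι → H} {C : ℝ}

theorem exists_forall_tendsto_inner_of_norm_le (hv : ∀ s, ‖v s‖ ≤ C) (U : Ultrafilter ι) :
    ∃ u : H, ∀ x, Tendsto (fun s => inner 𝕜 (v s) x) U (𝓝 (inner 𝕜 u x)) := by
  let D : ι → WeakDual 𝕜 H := fun s => StrongDual.toWeakDual (InnerProductSpace.toDual 𝕜 H (v s))
  have hmem : ↑(U.map D) ≤ 𝓟 (WeakDual.toStrongDual ⁻¹'
      Metric.closedBall (0 : StrongDual 𝕜 H) C) := by
    refine le_principal_iff.2 (mem_map.2 (univ_mem' fun s => ?_))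
    change InnerProductSpace.toDual 𝕜 H (v s) ∈ Metric.closedBall _ _
    simpa using hv s
  obtain ⟨d, -, hd⟩ := (WeakDual.isCompact_closedBall (0 : StrongDual 𝕜 H) C).ultrafilter_le_nhds
    (U.map D) hmem
  refine ⟨(InnerProductSpace.toDual 𝕜 H).symm (WeakDual.toStrongDual d), fun x => ?_⟩
  rw [InnerProductSpace.toDual_symm_apply]
  exact ((WeakDual.eval_continuous x).tendsto d).comp (show Tendsto D U (𝓝 d) from hd)

theorem tendsto_inner_cofinite_of_pairwise_inner_eq_zero (hv : ∀ s, ‖v s‖ ≤ C)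
    (horth : Pairwise fun s t => inner 𝕜 (v s) (v t) = 0) (x : H) :
    Tendsto (fun s => inner 𝕜 (v s) x) cofinite (𝓝 0) := by
  refine tendsto_iff_ultrafilter _ _ _ |>.2 fun U hU => ?_
  obtain ⟨u, hu⟩ := exists_forall_tendsto_inner_of_norm_le (𝕜 := 𝕜) hv U
  have hu_orth : ∀ t, inner 𝕜 u (v t) = 0 := fun t => by
    have hne : ∀ᶠ s in (U : Filter ι), s ≠ t := hU (Set.finite_singleton t).compl_mem_cofinite
    exact tendsto_nhds_unique (hu (v t))
      (tendsto_const_nhds.congr' (hne.mono fun s hs => (horth hs).symm))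
  have hu_zero : u = 0 := by
    refine inner_self_eq_zero (𝕜 := 𝕜).1 (tendsto_nhds_unique (hu u) ?_)
    simp only [inner_eq_zero_symm.1 (hu_orth _), tendsto_const_nhds]
  simpa [hu_zero] using hu x

end WeakCompactness

/-- Weak convergence of the functions `g s` to `f` along `l`, tested against indicator functions:
`∫_E g s ∂P → ∫_E f ∂P` for every measurable set `E`. For uniformly bounded functions on a finite
measure space this is weak convergence in `L²`. -/
def TendstoSetIntegral {Z ι : Type*} [MeasurableSpace Z] (P : Measure Z) (g : ι → Z → ℝ)
    (l : Filter ι) (f : Z → ℝ) : Prop :=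
  ∀ E, MeasurableSet E → Tendsto (fun s => ∫ z in E, g s z ∂P) l (𝓝 (∫ z in E, f z ∂P))

section TendstoSetIntegral

variable {Z ι : Type*} [MeasurableSpace Z] {P : Measure Z} {l : Filter ι}

theorem inner_toLp_indicatorConstLp_one [IsFiniteMeasure P] {g : Z → ℝ} (hg : MemLp g 2 P)
    {E : Set Z} (hE : MeasurableSet E) :
    inner ℝ hg.toLp (indicatorConstLp 2 hE (measure_ne_top P E) (1 : ℝ)) = ∫ z in E, g z ∂P := by
  rw [real_inner_comm, L2.inner_indicatorConstLp_one]
  exact setIntegral_congr_ae hE (hg.coeFn_toLp.mono fun z hz _ => hz)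

theorem norm_toLp_le_of_forall_norm_le [IsProbabilityMeasure P] {g : Z → ℝ} (hg : MemLp g 2 P)
    {C : ℝ} (hC : ∀ z, ‖g z‖ ≤ C) : ‖hg.toLp‖ ≤ C := by
  have := nonempty_of_isProbabilityMeasure P
  have hC0 : 0 ≤ C := (norm_nonneg _).trans (hC (Classical.arbitrary Z))
  have h := Lp.norm_le_of_ae_bound (f := hg.toLp) hC0
    (hg.coeFn_toLp.mono fun z hz => hz ▸ hC z)
  simpa [measureUnivNNReal] using h

theorem exists_tendstoSetIntegral_of_norm_le [IsProbabilityMeasure P] {g : ι → Z → ℝ} {C : ℝ}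
    (hg : ∀ s, AEStronglyMeasurable (g s) P) (hC : ∀ s z, ‖g s z‖ ≤ C) (U : Ultrafilter ι) :
    ∃ f : Z → ℝ, Measurable f ∧ Integrable f P ∧ TendstoSetIntegral P g U f := by
  have hL2 : ∀ s, MemLp (g s) 2 P := fun s => .of_bound (hg s) C (.of_forall (hC s))
  obtain ⟨f, hf⟩ := exists_forall_tendsto_inner_of_norm_le (𝕜 := ℝ)
    (fun s => norm_toLp_le_of_forall_norm_le (hL2 s) (hC s)) U
  refine ⟨f, (Lp.stronglyMeasurable f).measurable, (Lp.memLp f).integrable one_le_two,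
    fun E hE => ?_⟩
  have h := hf (indicatorConstLp 2 hE (measure_ne_top P E) 1)
  rw [real_inner_comm, L2.inner_indicatorConstLp_one] at h
  simpa only [inner_toLp_indicatorConstLp_one (hL2 _) hE] using h

theorem TendstoSetIntegral.ae_le [l.NeBot] {g g' : ι → Z → ℝ} {f f' : Z → ℝ}
    (h : TendstoSetIntegral P g l f) (h' : TendstoSetIntegral P g' l f')
    (hg : ∀ s, Integrable (g s) P) (hg' : ∀ s, Integrable (g' s) P)
    (hf : Integrable f P) (hf' : Integrable f' P) (hle : ∀ s z, g s z ≤ g' s z) :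
    f ≤ᵐ[P] f' :=
  ae_le_of_forall_setIntegral_le hf hf' fun E hE _ =>
    le_of_tendsto_of_tendsto' (h E hE) (h' E hE) fun s =>
      integral_mono (hg s).integrableOn (hg' s).integrableOn (hle s)

theorem tendstoSetIntegral_const (f : Z → ℝ) : TendstoSetIntegral P (fun _ : ι => f) l f :=
  fun _ _ => tendsto_const_nhds

theorem TendstoSetIntegral.sum {A : Type*} {a : Finset A} {g : A → ι → Z → ℝ} {f : A → Z → ℝ}
    (h : ∀ i ∈ a, TendstoSetIntegral P (g i) l (f i))
    (hg : ∀ i ∈ a, ∀ s, Integrable (g i s) P) (hf : ∀ i ∈ a, Integrable (f i) P) :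
    TendstoSetIntegral P (fun s z => ∑ i ∈ a, g i s z) l fun z => ∑ i ∈ a, f i z := by
  intro E hE
  rw [integral_finsetSum _ fun i hi => (hf i hi).integrableOn]
  simp only [integral_finsetSum _ fun i hi => (hg i hi _).integrableOn]
  exact tendsto_finsetSum _ fun i hi => h i hi E hE

theorem tendstoSetIntegral_const_of_pairwise_covariance_eq_zero [IsProbabilityMeasure P]
    {g : ι → Z → ℝ} {C p : ℝ} (hg : ∀ s, AEStronglyMeasurable (g s) P) (hC : ∀ s z, ‖g s z‖ ≤ C)
    (hmean : ∀ s, P[g s] = p) (hcov : Pairwise fun s t => cov[g s, g t; P] = 0) :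
    TendstoSetIntegral P g cofinite fun _ => p := by
  have hbound : ∀ s z, ‖g s z - p‖ ≤ C + ‖p‖ := fun s z =>
    (norm_sub_le _ _).trans (add_le_add_left (hC s z) _)
  have hL2 : ∀ s, MemLp (fun z => g s z - p) 2 P := fun s =>
    .of_bound ((hg s).sub aestronglyMeasurable_const) _ (.of_forall (hbound s))
  have horth : Pairwise fun s t => inner ℝ (hL2 s).toLp (hL2 t).toLp = 0 := fun s t hst => by
    change inner ℝ _ _ = _
    rw [L2.inner_def, ← hcov hst, covariance]
    refine integral_congr_ae ?_
    filter_upwards [(hL2 s).coeFn_toLp, (hL2 t).coeFn_toLp] with z hs ht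
    rw [hs, ht, hmean, hmean, RCLike.inner_apply, conj_trivial, mul_comm]
  intro E hE
  have h := tendsto_inner_cofinite_of_pairwise_inner_eq_zero
    (fun s => norm_toLp_le_of_forall_norm_le (hL2 s) (hbound s)) horth
    (indicatorConstLp 2 hE (measure_ne_top P E) 1)
  simp only [inner_toLp_indicatorConstLp_one (hL2 _) hE] at h
  refine tendsto_sub_nhds_zero_iff.1 (h.congr fun s => ?_)
  exact integral_sub (Integrable.of_bound (hg s) C (.of_forall (hC s))).integrableOn
    (integrable_const p).integrableOn

theorem TendstoSetIntegral.eventually_measure_inter_ne_zero {g : ι → Z → ℝ} {f : Z → ℝ}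
    (h : TendstoSetIntegral P g l f) (hf : Integrable f P) {E : Set Z} (hE : MeasurableSet E)
    (hPE : P E ≠ 0) (hpos : ∀ z ∈ E, 0 < f z) : ∀ᶠ s in l, P (E ∩ {z | 0 < g s z}) ≠ 0 := by
  have hsupp : E ⊆ Function.support f := fun z hz => (hpos z hz).ne'
  have hint : 0 < ∫ z in E, f z ∂P := by
    rw [setIntegral_pos_iff_support_of_nonneg_ae
      (ae_restrict_of_forall_mem hE fun z hz => (hpos z hz).le) hf.integrableOn,
      Set.inter_eq_right.2 hsupp]
    exact pos_iff_ne_zero.2 hPE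
  filter_upwards [(h E hE).eventually_const_lt hint] with s hs hzero
  refine hs.not_ge (setIntegral_nonpos_ae hE ?_)
  filter_upwards [measure_eq_zero_iff_ae_notMem.1 hzero] with z hz hzE
  exact not_lt.1 fun hlt => hz ⟨hzE, hlt⟩

end TendstoSetIntegral

theorem exists_infinite_forall_finset_of_forall_exists_insert {ι : Type*} [DecidableEq ι]
    {Q : Finset ι → Prop} (hanti : Antitone Q) (h_empty : Q ∅)
    (hinsert : ∀ J, Q J → ∃ s, s ∉ J ∧ Q (insert s J)) :
    ∃ H : Set ι, H.Infinite ∧ ∀ J : Finset ι, (J : Set ι) ⊆ H → Q J := by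
  have hchar : Order.IsOfFiniteCharacter {H : Set ι | ∀ J : Finset ι, (J : Set ι) ⊆ H → Q J} :=
    fun H => ⟨fun hH K hK _ J hJ => hH J (hJ.trans hK),
      fun hH J hJ => hH J hJ J.finite_toSet J subset_rfl⟩
  obtain ⟨H, -, hH⟩ := hchar.exists_maximal (x := ∅) fun J hJ => by
    rwa [Finset.coe_eq_empty.1 (Set.subset_empty_iff.1 hJ)]
  refine ⟨H, fun hfin => ?_, hH.prop⟩
  lift H to Finset ι using hfin
  obtain ⟨s, hs, hQ⟩ := hinsert H (hH.prop H subset_rfl)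
  have hmem : ∀ J : Finset ι, (J : Set ι) ⊆ ↑(insert s H) → Q J := fun J hJ =>
    hanti (Finset.coe_subset.1 hJ) hQ
  exact hs (hH.le_of_ge hmem (Finset.coe_subset.2 (Finset.subset_insert s H))
    (Finset.mem_insert_self s H))

theorem exists_infinite_forall_finset_exists_forall_pos {Z ι T K : Type*} [MeasurableSpace Z]
    [Finite T] [Finite K] {P : Measure Z} {l : Filter ι} [l.NeBot] (hl : l ≤ cofinite)
    {g : T → K → ι → Z → ℝ} {f : T → K → Z → ℝ} (hg : ∀ t j s, Measurable (g t j s))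
    (hf : ∀ t j, Measurable (f t j)) (hfi : ∀ t j, Integrable (f t j) P)
    (hlim : ∀ t j, TendstoSetIntegral P (g t j) l (f t j))
    (hpos : ∀ t, P {z | ∀ j, 0 < f t j z} ≠ 0) :
    ∃ H : Set ι, H.Infinite ∧ ∀ t, ∀ J : Finset ι, (J : Set ι) ⊆ H →
      ∀ τ : ι → K, ∃ z, ∀ s ∈ J, 0 < g t (τ s) s z := by
  classical
  let E : T → (J : Finset ι) → (J → K) → Set Z := fun t J σ =>
    {z | ∀ j, 0 < f t j z} ∩ {z | ∀ s : J, 0 < g t (σ s) s z}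
  have hE : ∀ t J σ, MeasurableSet (E t J σ) := fun t J σ => by
    refine .inter ?_ ?_ <;> simp only [Set.ofPred_forall]
    · exact .iInter fun j => measurableSet_lt measurable_const (hf t j)
    · exact .iInter fun s => measurableSet_lt measurable_const (hg t (σ s) s)
  have hinsert : ∀ J, (∀ t (τ : ι → K), P (E t J fun s => τ s) ≠ 0) →
      ∃ s, s ∉ J ∧ ∀ t (τ : ι → K), P (E t (insert s J) fun s => τ s) ≠ 0 := fun J hJ => by
    have hev : ∀ᶠ s in l, ∀ t (σ : J → K) j, P (E t J σ) ≠ 0 →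
        P (E t J σ ∩ {z | 0 < g t j s z}) ≠ 0 := by
      simp only [eventually_all]
      exact fun t σ j hσ => (hlim t j).eventually_measure_inter_ne_zero (hfi t j) (hE t J σ) hσ
        fun z hz => hz.1 j
    obtain ⟨s, hs, hsJ⟩ := (hev.and (hl J.finite_toSet.compl_mem_cofinite)).exists
    refine ⟨s, hsJ, fun t τ => ?_⟩
    convert hs t (fun s => τ s) (τ s) (hJ t τ) using 2
    ext z
    simp only [E, Finset.forall_mem_insert, Subtype.forall, Set.mem_inter_iff, Set.mem_ofPred_eq]
    tauto
  obtain ⟨H, hH, hHQ⟩ := exists_infinite_forall_finset_of_forall_exists_insert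
    (Q := fun J => ∀ t (τ : ι → K), P (E t J fun s => τ s) ≠ 0)
    (fun J J' hJJ' hJ' t τ => mt (measure_mono_null fun z hz => ⟨hz.1, fun s => hz.2 ⟨s, hJJ' s.2⟩⟩)
      (hJ' t τ))
    (fun t τ => by simpa [E] using hpos t) hinsert
  refine ⟨H, hH, fun t J hJ τ => ?_⟩
  obtain ⟨z, -, hz⟩ := nonempty_of_measure_ne_zero (hHQ J hJ t τ)
  exact ⟨z, fun s hs => hz ⟨s, hs⟩⟩

theorem measure_setOf_forall_pos_ne_zero {Z K : Type*} [Fintype K] [MeasurableSpace Z]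
    {P : Measure Z} {f : K → Z → ℝ} (h0 : ∀ᵐ z ∂P, ∀ j, 0 ≤ f j z)
    (h : 0 < ∫ z, ∏ j, f j z ∂P) : P {z | ∀ j, 0 < f j z} ≠ 0 := by
  intro hzero
  refine h.not_ge (integral_nonpos_of_ae ?_)
  filter_upwards [measure_eq_zero_iff_ae_notMem.1 hzero, h0] with z hz hz0
  obtain ⟨j, hj⟩ := not_forall.1 hz
  exact (Finset.prod_eq_zero (Finset.mem_univ j) (le_antisymm (not_lt.1 hj) (hz0 j))).le

section Coupling

theorem one_sub_sum_le_prod_one_sub {α R : Type*} [CommRing R] [LinearOrder R]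
    [IsStrictOrderedRing R] (s : Finset α) {u : α → R} (h0 : ∀ x ∈ s, 0 ≤ u x)
    (h1 : ∀ x ∈ s, u x ≤ 1) : 1 - ∑ x ∈ s, u x ≤ ∏ x ∈ s, (1 - u x) := by
  classical
  induction s using Finset.induction_on with
  | empty => simp
  | insert x s hx ih =>
    rw [Finset.forall_mem_insert] at h0 h1
    rw [Finset.sum_insert hx, Finset.prod_insert hx]
    calc 1 - (u x + ∑ y ∈ s, u y) ≤ (1 - u x) * (1 - ∑ y ∈ s, u y) := by
          linarith [mul_nonneg h0.1 (Finset.sum_nonneg h0.2)]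
      _ ≤ (1 - u x) * ∏ y ∈ s, (1 - u y) :=
          mul_le_mul_of_nonneg_left (ih h0.2 h1.2) (sub_nonneg.2 h1.1)

variable {K : Type*} [Fintype K] {L : K → Type*} [∀ j, Fintype (L j)] {Z : Type*}
  [MeasurableSpace Z] {P : Measure Z} [IsProbabilityMeasure P] {f : ∀ j, L j → Z → ℝ}

theorem integrable_prod_of_sum_le_one (hf : ∀ j l, AEStronglyMeasurable (f j l) P)
    (h0 : ∀ᵐ z ∂P, ∀ j l, 0 ≤ f j l z) (h1 : ∀ᵐ z ∂P, ∀ j, ∑ l, f j l z ≤ 1) (i : ∀ j, L j) :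
    Integrable (fun z => ∏ j, f j (i j) z) P := by
  refine .of_bound (Finset.aestronglyMeasurable_fun_prod _ fun j _ => hf j (i j)) 1 ?_
  filter_upwards [h0, h1] with z hz0 hz1
  rw [Real.norm_of_nonneg (Finset.prod_nonneg fun j _ => hz0 j _)]
  exact Finset.prod_le_one (fun j _ => hz0 j _) fun j _ =>
    (Finset.single_le_sum (fun l _ => hz0 j l) (Finset.mem_univ _)).trans (hz1 j)

variable [DecidableEq K]

theorem sum_integral_prod_le_one (hf : ∀ j l, AEStronglyMeasurable (f j l) P)
    (h0 : ∀ᵐ z ∂P, ∀ j l, 0 ≤ f j l z) (h1 : ∀ᵐ z ∂P, ∀ j, ∑ l, f j l z ≤ 1) :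
    ∑ i : ∀ j, L j, ∫ z, ∏ j, f j (i j) z ∂P ≤ 1 := by
  have hint := integrable_prod_of_sum_le_one hf h0 h1
  rw [← integral_finsetSum _ fun i _ => hint i]
  calc ∫ z, ∑ i : ∀ j, L j, ∏ j, f j (i j) z ∂P ≤ ∫ _, (1 : ℝ) ∂P := by
        refine integral_mono_ae (integrable_finsetSum _ fun i _ => hint i) (integrable_const 1) ?_
        filter_upwards [h0, h1] with z hz0 hz1
        rw [← Fintype.prod_sum fun j l => f j l z]
        exact Finset.prod_le_one (fun j _ => Finset.sum_nonneg fun l _ => hz0 j l) fun j _ => hz1 j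
    _ = 1 := by simp

variable [∀ j, DecidableEq (L j)]

theorem sum_filter_prod_eq_mul_prod_erase {R : Type*} [CommSemiring R] (a : ∀ j, L j → R) (j : K)
    (l : L j) :
    ∑ i : ∀ j, L j with i j = l, ∏ j', a j' (i j') =
      a j l * ∏ j' ∈ Finset.univ.erase j, ∑ l', a j' l' := by
  rw [← Fintype.piFinset_univ, ← Fintype.piFinset_update_singleton_eq_filter_piFinset_eq _ j
    (Finset.mem_univ l), ← Finset.prod_univ_sum, ← Finset.mul_prod_erase _ _ (Finset.mem_univ j)]
  congr 1
  · simp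
  · refine Finset.prod_congr rfl fun j' hj' => ?_
    rw [Function.update_of_ne (Finset.ne_of_mem_erase hj')]

theorem sub_sum_one_sub_sum_le_sum_filter_prod {R : Type*} [CommRing R] [LinearOrder R]
    [IsStrictOrderedRing R] {a : ∀ j, L j → R} (h0 : ∀ j l, 0 ≤ a j l) (h1 : ∀ j, ∑ l, a j l ≤ 1)
    (j : K) (l : L j) :
    a j l - ∑ j', (1 - ∑ l', a j' l') ≤ ∑ i : ∀ j, L j with i j = l, ∏ j', a j' (i j') := by
  have hdef0 : ∀ j', 0 ≤ 1 - ∑ l', a j' l' := fun j' => sub_nonneg.2 (h1 j')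
  have hdef1 : ∀ j', 1 - ∑ l', a j' l' ≤ 1 := fun j' =>
    sub_le_self _ (Finset.sum_nonneg fun l' _ => h0 j' l')
  have hle1 : a j l ≤ 1 :=
    (Finset.single_le_sum (fun l' _ => h0 j l') (Finset.mem_univ l)).trans (h1 j)
  have hsum0 : 0 ≤ ∑ j', (1 - ∑ l', a j' l') := Finset.sum_nonneg fun j' _ => hdef0 j'
  rw [sum_filter_prod_eq_mul_prod_erase]
  calc a j l - ∑ j', (1 - ∑ l', a j' l')
      ≤ a j l * (1 - ∑ j', (1 - ∑ l', a j' l')) := by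
        linarith [mul_le_of_le_one_left hsum0 hle1]
    _ ≤ a j l * (1 - ∑ j' ∈ Finset.univ.erase j, (1 - ∑ l', a j' l')) := by
        gcongr
        · exact h0 j l
        · exact fun j' _ _ => hdef0 j'
        · exact Finset.erase_subset _ _
    _ ≤ a j l * ∏ j' ∈ Finset.univ.erase j, (1 - (1 - ∑ l', a j' l')) := by
        gcongr
        · exact h0 j l
        · exact one_sub_sum_le_prod_one_sub _ (fun j' _ => hdef0 j') fun j' _ => hdef1 j'
    _ = a j l * ∏ j' ∈ Finset.univ.erase j, ∑ l', a j' l' := by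
        simp only [sub_sub_cancel]

theorem sub_sum_one_sub_sum_le_sum_filter_integral_prod (hf : ∀ j l, Integrable (f j l) P)
    (h0 : ∀ᵐ z ∂P, ∀ j l, 0 ≤ f j l z) (h1 : ∀ᵐ z ∂P, ∀ j, ∑ l, f j l z ≤ 1)
    {c : ∀ j, L j → ℝ} (hc : ∀ j l, c j l ≤ ∫ z, f j l z ∂P) (j : K) (l : L j) :
    c j l - ∑ j', (1 - ∑ l', c j' l') ≤
      ∑ i : ∀ j, L j with i j = l, ∫ z, ∏ j, f j (i j) z ∂P := by
  have hint := integrable_prod_of_sum_le_one (fun j l => (hf j l).aestronglyMeasurable) h0 h1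
  have hsum : ∀ j, Integrable (fun z => ∑ l, f j l z) P := fun j =>
    integrable_finsetSum _ fun l _ => hf j l
  have hdef : ∀ j, Integrable (fun z => 1 - ∑ l, f j l z) P := fun j =>
    (integrable_const 1).sub (hsum j)
  calc c j l - ∑ j', (1 - ∑ l', c j' l')
      ≤ ∫ z, f j l z ∂P - ∑ j', (1 - ∑ l', ∫ z, f j' l' z ∂P) := by
        gcongr <;> exact hc _ _
    _ = ∫ z, (f j l z - ∑ j', (1 - ∑ l', f j' l' z)) ∂P := by
        rw [integral_sub (hf j l) (integrable_finsetSum _ fun j' _ => hdef j'),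
          integral_finsetSum _ fun j' _ => hdef j']
        simp only [integral_sub (integrable_const _) (hsum _),
          integral_finsetSum _ fun l' _ => hf _ l', integral_const, probReal_univ, one_smul]
    _ ≤ ∫ z, ∑ i : ∀ j, L j with i j = l, ∏ j, f j (i j) z ∂P := by
        refine integral_mono_ae ((hf j l).sub (integrable_finsetSum _ fun j' _ => hdef j'))
          (integrable_finsetSum _ fun i _ => hint i) ?_
        filter_upwards [h0, h1] with z hz0 hz1
        exact sub_sum_one_sub_sum_le_sum_filter_prod hz0 hz1 j l
    _ = _ := integral_finsetSum _ fun i _ => hint i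

end Coupling

section Colouring

variable {ι : Type*} {k : ℕ}

/-- The law of a random colouring of `ι` by `k` colours: the colours of the elements of `ι` are
independent and uniformly distributed. -/
noncomputable def uniformColouring (ι : Type*) (k : ℕ) [NeZero k] : Measure (ι → Fin k) :=
  Measure.infinitePi fun _ => (PMF.uniformOfFintype (Fin k)).toMeasure

instance [NeZero k] : IsProbabilityMeasure (uniformColouring ι k) :=
  inferInstanceAs (IsProbabilityMeasure (Measure.infinitePi _))

/-- The density of the point mass at the colour `j` with respect to the uniform law on the `k`
colours. Multiplying by it amounts to conditioning on the colour `j`. -/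
noncomputable def colourDensity (j a : Fin k) : ℝ :=
  if a = j then k else 0

theorem colourDensity_nonneg (j a : Fin k) : 0 ≤ colourDensity j a := by
  unfold colourDensity; positivity

theorem colourDensity_le (j a : Fin k) : colourDensity j a ≤ k := by
  unfold colourDensity; split_ifs <;> simp

theorem norm_colourDensity_le (j a : Fin k) : ‖colourDensity j a‖ ≤ k := by
  rw [Real.norm_of_nonneg (colourDensity_nonneg j a)]
  exact colourDensity_le j a

@[fun_prop]
theorem continuous_colourDensity (j : Fin k) : Continuous (colourDensity j) :=
  continuous_of_discreteTopology

@[fun_prop]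
theorem measurable_colourDensity (j : Fin k) : Measurable (colourDensity j) :=
  .of_discrete

theorem aestronglyMeasurable_colourDensity_apply (j : Fin k) (s : ι) (P : Measure (ι → Fin k)) :
    AEStronglyMeasurable (fun σ => colourDensity j (σ s)) P :=
  ((measurable_colourDensity j).comp (measurable_pi_apply s)).aestronglyMeasurable

variable [NeZero k]

theorem integral_colourDensity (j : Fin k) (s : ι) :
    ∫ σ, colourDensity j (σ s) ∂uniformColouring ι k = 1 := by
  rw [← integral_map (φ := fun σ : ι → Fin k => σ s) (measurable_pi_apply s).aemeasurable
    (by fun_prop),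
    uniformColouring, Measure.infinitePi_map_eval, PMF.integral_eq_sum]
  simp [colourDensity, NeZero.ne]

theorem covariance_colourDensity (j : Fin k) {s t : ι} (hst : s ≠ t) :
    cov[fun σ => colourDensity j (σ s), fun σ => colourDensity j (σ t); uniformColouring ι k] =
      0 := by
  have hindep : iIndepFun (fun s σ => colourDensity j (σ s)) (uniformColouring ι k) :=
    iIndepFun_infinitePi (X := fun _ => colourDensity j) fun _ => .of_discrete
  have hL2 : ∀ s, MemLp (fun σ => colourDensity j (σ s)) 2 (uniformColouring ι k) := fun s =>
    .of_bound (aestronglyMeasurable_colourDensity_apply j s _) k (.of_forall fun σ =>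
      norm_colourDensity_le j (σ s))
  exact (hindep.indepFun hst).covariance_eq_zero (hL2 s) (hL2 t)

theorem tendstoSetIntegral_colourDensity {Z : Type*} [MeasurableSpace Z] {P : Measure Z}
    [IsProbabilityMeasure P] {σ : Z → ι → Fin k} (hσ : MeasurePreserving σ P (uniformColouring ι k))
    (j : Fin k) :
    TendstoSetIntegral P (fun s z => colourDensity j (σ z s)) cofinite fun _ => 1 := by
  have hσm := hσ.measurable
  refine tendstoSetIntegral_const_of_pairwise_covariance_eq_zero (C := k) (fun s => by fun_prop)
    (fun s z => norm_colourDensity_le j (σ z s)) (fun s => ?_) fun s t hst => ?_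
  · rw [← integral_colourDensity j s, ← hσ.map_eq, integral_map hσm.aemeasurable
      (aestronglyMeasurable_colourDensity_apply j s _)]
  · rw [← covariance_colourDensity j hst, ← hσ.map_eq,
      covariance_map_fun (aestronglyMeasurable_colourDensity_apply j s _)
        (aestronglyMeasurable_colourDensity_apply j t _) hσm.aemeasurable]

theorem le_integral_colourDensity_mul {X : Type*} [MeasurableSpace X] (κ : Kernel (ι → Fin k) X)
    [IsMarkovKernel κ] {φ : X → ℝ} (hφ : Measurable φ) {B c : ℝ} (hB : ∀ x, ‖φ x‖ ≤ B) (s : ι)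
    (j : Fin k) (hc : ∀ σ : ι → Fin k, σ s = j → c ≤ ∫ x, φ x ∂κ σ) :
    c ≤ ∫ z, colourDensity j (z.1 s) * φ z.2 ∂(uniformColouring ι k ⊗ₘ κ) := by
  have hint : Integrable (fun z => φ z.2) (uniformColouring ι k ⊗ₘ κ) :=
    .of_bound (hφ.comp measurable_snd).aestronglyMeasurable B (.of_forall fun z => hB z.2)
  have hκ : Integrable (fun σ => ∫ x, φ x ∂κ σ) (uniformColouring ι k) :=
    .of_bound hφ.stronglyMeasurable.integral_kernel.aestronglyMeasurable B (.of_forall fun σ => by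
      simpa using norm_integral_le_of_norm_le_const (μ := κ σ) (.of_forall hB))
  rw [Measure.integral_compProd (hint.bdd_mul (c := k) (by fun_prop)
    (.of_forall fun z => norm_colourDensity_le j (z.1 s)))]
  simp only [integral_const_mul]
  have hmeas := aestronglyMeasurable_colourDensity_apply j s (uniformColouring ι k)
  have hbound : ∀ᵐ σ ∂uniformColouring ι k, ‖colourDensity j (σ s)‖ ≤ k :=
    .of_forall fun σ => norm_colourDensity_le j (σ s)
  calc c = ∫ σ, colourDensity j (σ s) * c ∂uniformColouring ι k := by
        rw [integral_mul_const, integral_colourDensity, one_mul]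
    _ ≤ ∫ σ, colourDensity j (σ s) * ∫ x, φ x ∂κ σ ∂uniformColouring ι k := by
        refine integral_mono ((integrable_const c).bdd_mul hmeas hbound)
          (hκ.bdd_mul hmeas hbound) fun σ => ?_
        by_cases h : σ s = j
        · exact mul_le_mul_of_nonneg_left (hc σ h) (colourDensity_nonneg _ _)
        · simp [colourDensity, h]

variable {X : Type*} [MeasurableSpace X] {L : Fin k → Type*}

theorem exists_kernel_forall_le_integral {φ : ι → ∀ j, L j → X → ℝ} {c : ∀ j, L j → ℝ}
    (J : Finset ι)
    (h : ∀ σ : ι → Fin k, ∃ ν : ProbabilityMeasure X, ∀ s ∈ J, ∀ l,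
      c (σ s) l ≤ ∫ x, φ s (σ s) l x ∂(ν : Measure X)) :
    ∃ κ : Kernel (ι → Fin k) X, IsMarkovKernel κ ∧ ∀ σ, ∀ s ∈ J, ∀ l,
      c (σ s) l ≤ ∫ x, φ s (σ s) l x ∂κ σ := by
  have hJ : ∀ τ : J → Fin k, ∃ ν : ProbabilityMeasure X, ∀ (s : J) l,
      c (τ s) l ≤ ∫ x, φ s (τ s) l x ∂(ν : Measure X) := fun τ => by
    obtain ⟨σ, rfl⟩ := Subtype.val_injective.surjective_comp_right τ
    obtain ⟨ν, hν⟩ := h σ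
    exact ⟨ν, fun s => hν s s.2⟩
  choose ν hν using hJ
  let κ : Kernel (J → Fin k) X := ⟨fun τ => (ν τ : Measure X), measurable_of_countable _⟩
  have : IsMarkovKernel κ := ⟨fun τ => inferInstanceAs (IsProbabilityMeasure (ν τ : Measure X))⟩
  exact ⟨κ.comap J.restrict (by fun_prop), inferInstance, fun σ s hs =>
    hν (J.restrict σ) ⟨s, hs⟩⟩

variable [Countable ι] [TopologicalSpace X] [CompactSpace X]
  [TopologicalSpace.MetrizableSpace X] [BorelSpace X]

theorem exists_measurePreserving_fst_forall_le_integral {φ : ι → ∀ j, L j → C(X, ℝ)}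
    {c : ∀ j, L j → ℝ}
    (h : ∀ (J : Finset ι) (σ : ι → Fin k), ∃ ν : ProbabilityMeasure X, ∀ s ∈ J, ∀ l,
      c (σ s) l ≤ ∫ x, φ s (σ s) l x ∂(ν : Measure X)) :
    ∃ P : ProbabilityMeasure ((ι → Fin k) × X),
      MeasurePreserving Prod.fst (P : Measure ((ι → Fin k) × X)) (uniformColouring ι k) ∧
      ∀ s j l, c j l ≤
        ∫ z, colourDensity j (z.1 s) * φ s j l z.2 ∂(P : Measure ((ι → Fin k) × X)) := by
  let β : ProbabilityMeasure (ι → Fin k) := ⟨uniformColouring ι k, inferInstance⟩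
  let M : Set (ProbabilityMeasure ((ι → Fin k) × X)) :=
    {P | P.map measurable_fst.aemeasurable = β}
  have hM : IsClosed M := isClosed_eq (ProbabilityMeasure.continuous_map continuous_fst)
    continuous_const
  let F : ι → Set (ProbabilityMeasure ((ι → Fin k) × X)) := fun s =>
    {P | ∀ j l, c j l ≤
      ∫ z, colourDensity j (z.1 s) * φ s j l z.2 ∂(P : Measure ((ι → Fin k) × X))}
  have hF : ∀ s, IsClosed (F s) := fun s => by
    simp only [F, Set.ofPred_forall]
    refine isClosed_iInter fun j => isClosed_iInter fun l => isClosed_le continuous_const ?_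
    let ψ : C((ι → Fin k) × X, ℝ) := ⟨fun z => colourDensity j (z.1 s) * φ s j l z.2, by fun_prop⟩
    exact ProbabilityMeasure.continuous_integral_boundedContinuousFunction (.mkOfCompact ψ)
  have hfin : ∀ J : Finset ι, (M ∩ ⋂ s ∈ J, F s).Nonempty := fun J => by
    obtain ⟨κ, hκ, hle⟩ :=
      exists_kernel_forall_le_integral (φ := fun s j l => φ s j l) (c := c) J (h J)
    refine ⟨⟨uniformColouring ι k ⊗ₘ κ, inferInstance⟩, Subtype.ext (Measure.fst_compProd _ κ),
      Set.mem_iInter₂.2 fun s hs j l => ?_⟩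
    exact le_integral_colourDensity_mul κ (φ s j l).continuous.measurable
      (φ s j l).norm_coe_le_norm s j fun σ hσ => by subst hσ; exact hle σ s hs l
  obtain ⟨P, hPM, hPF⟩ := hM.isCompact.inter_iInter_nonempty F hF hfin
  exact ⟨P, ⟨measurable_fst, congrArg Subtype.val hPM⟩, Set.mem_iInter.1 hPF⟩

end Colouring

section AtomicMeasures

open scoped ENNReal

variable {X I : Type*} [TopologicalSpace X] [T1Space X] [MeasurableSpace X] [Fintype I]

theorem encard_support_le_card_of_measure_compl_range_eq_zero {μ : Measure X} {y : I → X}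
    (h : μ (Set.range y)ᶜ = 0) : μ.support.encard ≤ Fintype.card I :=
  calc μ.support.encard ≤ (Set.range y).encard :=
        Set.encard_le_encard (Measure.support_subset_of_isClosed (Set.finite_range y).isClosed h)
    _ ≤ (Set.univ : Set I).encard := Set.image_univ (f := y) ▸ Set.encard_image_le y Set.univ
    _ = Fintype.card I := by rw [Set.encard_univ, ENat.card_eq_coe_fintype_card]

variable [Nonempty I] [OpensMeasurableSpace X]

theorem exists_sum_smul_dirac_le_probabilityMeasure {w : I → ℝ≥0∞}
    (hw : ∑ i, w i ≤ 1) (y : I → X) :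
    ∃ ν : ProbabilityMeasure X, (ν : Measure X).support.encard ≤ Fintype.card I ∧
      ∑ i, w i • Measure.dirac (y i) ≤ (ν : Measure X) := by
  let i₀ := Classical.arbitrary I
  let m : Measure X := ∑ i, w i • Measure.dirac (y i) + (1 - ∑ i, w i) • Measure.dirac (y i₀)
  have hm : IsProbabilityMeasure m := ⟨by simp [m, add_tsub_cancel_of_le hw]⟩
  refine ⟨⟨m, hm⟩, encard_support_le_card_of_measure_compl_range_eq_zero (y := y) ?_,
    Measure.le_add_right le_rfl⟩
  change m _ = 0
  simp [m, Measure.dirac_apply]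

theorem exists_probabilityMeasure_forall_sum_le_measureReal {w : I → ℝ}
    (hw0 : ∀ i, 0 ≤ w i) (hw1 : ∑ i, w i ≤ 1) (y : I → X) :
    ∃ ν : ProbabilityMeasure X, (ν : Measure X).support.encard ≤ Fintype.card I ∧
      ∀ (B : Set X) (s : Finset I), (∀ i ∈ s, 0 < w i → y i ∈ B) →
        ∑ i ∈ s, w i ≤ (ν : Measure X).real B := by
  obtain ⟨ν, hcard, hν⟩ := exists_sum_smul_dirac_le_probabilityMeasure
    (w := fun i => ENNReal.ofReal (w i))
    (by rwa [← ENNReal.ofReal_sum_of_nonneg fun i _ => hw0 i, ENNReal.ofReal_le_one]) y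
  refine ⟨ν, hcard, fun B s hs => ?_⟩
  rw [measureReal_def, ← ENNReal.ofReal_le_iff_le_toReal (measure_ne_top _ B)]
  calc ENNReal.ofReal (∑ i ∈ s, w i) = ∑ i ∈ s, ENNReal.ofReal (w i) :=
        ENNReal.ofReal_sum_of_nonneg fun i _ => hw0 i
    _ ≤ ∑ i ∈ s, (ENNReal.ofReal (w i) • Measure.dirac (y i)) B :=
        Finset.sum_le_sum fun i hi => by
          rcases (hw0 i).eq_or_lt with h | h
          · simp [← h]
          · simp [hs i hi h]
    _ ≤ ∑ i, (ENNReal.ofReal (w i) • Measure.dirac (y i)) B :=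
        Finset.sum_le_sum_of_subset (Finset.subset_univ s)
    _ ≤ (ν : Measure X) B := by simpa only [Measure.finsetSum_apply] using hν B

end AtomicMeasures

section IndependentAtoms

variable {ι X : Type*} {k : ℕ} [NeZero k] [MeasurableSpace X] {L : Fin k → Type*}
  [∀ j, Fintype (L j)]

theorem exists_tendstoSetIntegral_colourDensity_mul {P : Measure ((ι → Fin k) × X)}
    [IsProbabilityMeasure P] (hP : MeasurePreserving Prod.fst P (uniformColouring ι k))
    {φ : ι → ∀ j, L j → X → ℝ} (hφ : ∀ s j l, Measurable (φ s j l)) (h0 : ∀ s j l x, 0 ≤ φ s j l x)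
    (h1 : ∀ s j x, ∑ l, φ s j l x ≤ 1) {U : Ultrafilter ι} (hU : ↑U ≤ (cofinite : Filter ι)) :
    ∃ f : ∀ j, L j → (ι → Fin k) × X → ℝ, (∀ j l, Measurable (f j l)) ∧
      (∀ j l, Integrable (f j l) P) ∧
      (∀ j l, TendstoSetIntegral P (fun s z => colourDensity j (z.1 s) * φ s j l z.2) U (f j l)) ∧
      (∀ᵐ z ∂P, ∀ j l, 0 ≤ f j l z) ∧ ∀ᵐ z ∂P, ∀ j, ∑ l, f j l z ≤ 1 := by
  let g : ∀ j, L j → ι → (ι → Fin k) × X → ℝ := fun j l s z =>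
    colourDensity j (z.1 s) * φ s j l z.2
  have hcol : ∀ j s, Measurable fun z : (ι → Fin k) × X => colourDensity j (z.1 s) := by fun_prop
  have hgm : ∀ j l s, AEStronglyMeasurable (g j l s) P := fun j l s =>
    ((hcol j s).mul ((hφ s j l).comp measurable_snd)).aestronglyMeasurable
  have hg0 : ∀ j l s z, 0 ≤ g j l s z := fun j l s z =>
    mul_nonneg (colourDensity_nonneg _ _) (h0 s j l z.2)
  have hgsum : ∀ j s z, ∑ l, g j l s z ≤ colourDensity j (z.1 s) := fun j s z => by
    simp only [g, ← Finset.mul_sum]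
    exact mul_le_of_le_one_right (colourDensity_nonneg _ _) (h1 s j z.2)
  have hgk : ∀ j l s z, ‖g j l s z‖ ≤ k := fun j l s z => by
    rw [Real.norm_of_nonneg (hg0 j l s z)]
    exact ((Finset.single_le_sum (fun l _ => hg0 j l s z) (Finset.mem_univ l)).trans
      (hgsum j s z)).trans (colourDensity_le j _)
  have hgi : ∀ j l s, Integrable (g j l s) P := fun j l s =>
    .of_bound (hgm j l s) k (.of_forall (hgk j l s))
  choose f hfm hfi hf using fun j l => exists_tendstoSetIntegral_of_norm_le (hgm j l) (hgk j l) U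
  refine ⟨f, hfm, hfi, hf, ?_, ?_⟩
  · exact ae_all_iff.2 fun j => ae_all_iff.2 fun l => (tendstoSetIntegral_const 0).ae_le (hf j l)
      (fun _ => integrable_zero _ _ _) (hgi j l) (integrable_zero _ _ _) (hfi j l) (hg0 j l)
  · exact ae_all_iff.2 fun j => TendstoSetIntegral.ae_le
      (.sum (fun l _ => hf j l) (fun l _ => hgi j l) fun l _ => hfi j l)
      (fun E hE => (tendstoSetIntegral_colourDensity hP j E hE).mono_left hU)
      (fun s => integrable_finsetSum _ fun l _ => hgi j l s)
      (fun s => .of_bound (hcol j s).aestronglyMeasurable k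
        (.of_forall fun z => norm_colourDensity_le j (z.1 s)))
      (integrable_finsetSum _ fun l _ => hfi j l) (integrable_const 1) (hgsum j)

variable [TopologicalSpace X] [CompactSpace X] [TopologicalSpace.MetrizableSpace X] [BorelSpace X]
  [Countable ι] [Infinite ι] [∀ j, Nonempty (L j)]

theorem exists_infinite_forall_finset_exists_probabilityMeasure
    {φ : ι → ∀ j, L j → C(X, ℝ)} (h0 : ∀ s j l x, 0 ≤ φ s j l x)
    (h1 : ∀ s j x, ∑ l, φ s j l x ≤ 1) {c : ∀ j, L j → ℝ}
    (h : ∀ (J : Finset ι) (σ : ι → Fin k), ∃ ν : ProbabilityMeasure X, ∀ s ∈ J, ∀ l,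
      c (σ s) l ≤ ∫ x, φ s (σ s) l x ∂(ν : Measure X)) :
    ∃ H : Set ι, H.Infinite ∧ ∀ J : Finset ι, (J : Set ι) ⊆ H → ∀ τ : ι → Fin k,
      ∃ ν : ProbabilityMeasure X, (ν : Measure X).support.encard ≤ Fintype.card (∀ j, L j) ∧
        ∀ s ∈ J, ∀ l, c (τ s) l - ∑ j, (1 - ∑ l', c j l') ≤
          (ν : Measure X).real {x | 0 < φ s (τ s) l x} := by
  classical
  obtain ⟨P, hP, hPc⟩ := exists_measurePreserving_fst_forall_le_integral h
  obtain ⟨f, hfm, hfi, hf, hf0, hf1⟩ := exists_tendstoSetIntegral_colourDensity_mul hP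
    (fun s j l => (φ s j l).continuous.measurable) h0 h1 (hyperfilter_le_cofinite (α := ι))
  have hgm : ∀ s j l, Measurable fun z : (ι → Fin k) × X =>
      colourDensity j (z.1 s) * φ s j l z.2 := fun s j l => by
    have := (φ s j l).continuous.measurable
    fun_prop
  have hfc : ∀ j l, c j l ≤ ∫ z, f j l z ∂P := fun j l => by
    simpa using ge_of_tendsto' (hf j l Set.univ .univ) fun s => by simpa using hPc s j l
  let w : (∀ j, L j) → ℝ := fun i => ∫ z, ∏ j, f j (i j) z ∂P
  have hw0 : ∀ i, 0 ≤ w i := fun i => integral_nonneg_of_ae <| hf0.mono fun z hz =>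
    Finset.prod_nonneg fun j _ => hz j (i j)
  obtain ⟨H, hH, hHpos⟩ := exists_infinite_forall_finset_exists_forall_pos
    (hyperfilter_le_cofinite (α := ι))
    (g := fun (i : {i // 0 < w i}) j s z => colourDensity j (z.1 s) * φ s j (i.1 j) z.2)
    (fun i j s => hgm s j (i.1 j))
    (fun i j => hfm j (i.1 j)) (fun i j => hfi j (i.1 j)) (fun i j => hf j (i.1 j))
    fun i => measure_setOf_forall_pos_ne_zero (hf0.mono fun z hz j => hz j (i.1 j)) i.2
  refine ⟨H, hH, fun J hJ τ => ?_⟩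
  have hy : ∀ i, ∃ y : X, 0 < w i → ∀ s ∈ J, 0 < φ s (τ s) (i (τ s)) y := fun i => by
    by_cases hi : 0 < w i
    · obtain ⟨z, hz⟩ := hHpos ⟨i, hi⟩ J hJ τ
      exact ⟨z.2, fun _ s hs => pos_of_mul_pos_right (hz s hs) (colourDensity_nonneg _ _)⟩
    · obtain ⟨⟨_, x⟩⟩ := nonempty_of_isProbabilityMeasure (P : Measure ((ι → Fin k) × X))
      exact ⟨x, fun h => absurd h hi⟩
  choose y hy using hy
  obtain ⟨ν, hcard, hν⟩ := exists_probabilityMeasure_forall_sum_le_measureReal hw0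
    (sum_integral_prod_le_one (fun j l => (hfi j l).aestronglyMeasurable) hf0 hf1) y
  refine ⟨ν, hcard, fun s hs l => ?_⟩
  calc c (τ s) l - ∑ j, (1 - ∑ l', c j l') ≤ ∑ i with i (τ s) = l, w i :=
        sub_sum_one_sub_sum_le_sum_filter_integral_prod hfi hf0 hf1 hfc (τ s) l
    _ ≤ (ν : Measure X).real {x | 0 < φ s (τ s) l x} := hν _ _ fun i hi hwi => by
        obtain rfl := (Finset.mem_filter.1 hi).2
        exact hy i hwi s hs

end IndependentAtoms

section FinitelySupported

variable {X : Type*} [PseudoMetricSpace X]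

/-- The tent function of radius `r` centred at `a`: it equals `1` at `a` and is positive exactly
on the ball of radius `r > 0` around `a`. -/
noncomputable def tent (a : X) (r : ℝ) : C(X, ℝ) :=
  ⟨fun x => max 0 (1 - dist x a / r), by fun_prop⟩

theorem tent_nonneg (a : X) (r : ℝ) (x : X) : 0 ≤ tent a r x :=
  le_max_left _ _

theorem tent_self (a : X) (r : ℝ) : tent a r a = 1 := by
  simp [tent]

theorem tent_le_one (a : X) {r : ℝ} (hr : 0 < r) (x : X) : tent a r x ≤ 1 :=
  max_le zero_le_one (sub_le_self _ (div_nonneg dist_nonneg hr.le))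

theorem tent_pos_iff {a x : X} {r : ℝ} (hr : 0 < r) : 0 < tent a r x ↔ x ∈ Metric.ball a r := by
  simp [tent, div_lt_one hr]

variable {I : Type*} {a : I → X} {r : ℝ}

theorem sum_tent_le_one [Fintype I] (hr : 0 < r)
    (hdisj : Pairwise (Function.onFun Disjoint fun i => Metric.ball (a i) r)) (x : X) :
    ∑ i, tent (a i) r x ≤ 1 := by
  by_cases hx : ∃ i, x ∈ Metric.ball (a i) r
  · obtain ⟨i, hi⟩ := hx
    refine (Finset.sum_eq_single_of_mem i (Finset.mem_univ i) fun j _ hji => ?_).trans_le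
      (tent_le_one (a i) hr x)
    refine le_antisymm (not_lt.1 fun hpos => ?_) (tent_nonneg _ _ x)
    exact Set.disjoint_left.1 (hdisj hji) ((tent_pos_iff hr).1 hpos) hi
  · refine (Finset.sum_nonpos fun i _ => not_lt.1 fun hpos => ?_).trans zero_le_one
    exact hx ⟨i, (tent_pos_iff hr).1 hpos⟩

variable [MeasurableSpace X] [OpensMeasurableSpace X]

theorem levyProkhorovDist_le_of_forall_sub_le_measureReal_ball [Fintype I] {μ ν : Measure X}
    [IsProbabilityMeasure μ] [IsProbabilityMeasure ν] (hμ : μ (Set.range a)ᶜ = 0) {ε δ : ℝ}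
    (hε : 0 ≤ ε) (hr : r ≤ δ) (hδ : Fintype.card I * ε ≤ δ)
    (hdisj : Pairwise (Function.onFun Disjoint fun i => Metric.ball (a i) r))
    (h : ∀ i, μ.real {a i} - ε ≤ ν.real (Metric.ball (a i) r)) : levyProkhorovDist μ ν ≤ δ := by
  classical
  have hδ0 : 0 ≤ δ := (mul_nonneg (Nat.cast_nonneg _) hε).trans hδ
  refine levyProkhorovDist_le_of_forall_le μ ν hδ0 fun δ' B hδ' _ => ?_
  let T : Finset I := {i | a i ∈ B}
  have hBT : B ⊆ (⋃ i ∈ T, {a i}) ∪ (Set.range a)ᶜ := fun x hx => by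
    by_cases hxa : x ∈ Set.range a
    · obtain ⟨i, rfl⟩ := hxa
      exact .inl (Set.mem_biUnion (by simpa [T] using hx) rfl)
    · exact .inr hxa
  have hballs : (⋃ i ∈ T, Metric.ball (a i) r) ⊆ Metric.thickening δ' B :=
    Set.iUnion₂_subset fun i hi => (Metric.ball_subset_ball (hr.trans hδ'.le)).trans
      (Metric.ball_subset_thickening (by simpa [T] using hi) δ')
  have hreal : μ.real B ≤ ν.real (Metric.thickening δ' B) + δ' :=
    calc μ.real B ≤ μ.real (⋃ i ∈ T, {a i}) + μ.real (Set.range a)ᶜ :=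
          (measureReal_mono hBT).trans (measureReal_union_le _ _)
      _ ≤ ∑ i ∈ T, μ.real {a i} := by
          rw [measureReal_def μ (Set.range a)ᶜ, hμ, ENNReal.toReal_zero, add_zero]
          exact measureReal_biUnion_finset_le _ _
      _ ≤ ∑ i ∈ T, (ν.real (Metric.ball (a i) r) + ε) :=
          Finset.sum_le_sum fun i _ => sub_le_iff_le_add.1 (h i)
      _ = ν.real (⋃ i ∈ T, Metric.ball (a i) r) + T.card * ε := by
          rw [Finset.sum_add_distrib, Finset.sum_const, nsmul_eq_mul,
            measureReal_biUnion_finset (hdisj.set_pairwise _) fun i _ => measurableSet_ball]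
      _ ≤ ν.real (Metric.thickening δ' B) + δ' := by
          have hT : (T.card : ℝ) ≤ Fintype.card I := by exact_mod_cast T.card_le_univ
          exact add_le_add (measureReal_mono hballs)
            (((mul_le_mul_of_nonneg_right hT hε).trans hδ).trans hδ'.le)
  rw [← ofReal_measureReal, ← ofReal_measureReal (μ := ν),
    ← ENNReal.ofReal_add measureReal_nonneg (hδ0.trans hδ'.le)]
  exact ENNReal.ofReal_le_ofReal hreal

theorem setOf_forall_sub_le_integral_tent_mem_nhds [Finite I] [CompactSpace X]
    [MeasurableSingletonClass X] (μ : ProbabilityMeasure X) {η : ℝ} (hη : 0 < η) :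
    {ν : ProbabilityMeasure X | ∀ i, (μ : Measure X).real {a i} - η ≤
      ∫ x, tent (a i) r x ∂(ν : Measure X)} ∈ 𝓝 μ := by
  simp only [Set.ofPred_forall]
  refine iInter_mem.2 fun i => ?_
  have hcont : Continuous fun ν : ProbabilityMeasure X => ∫ x, tent (a i) r x ∂(ν : Measure X) :=
    ProbabilityMeasure.continuous_integral_boundedContinuousFunction (.mkOfCompact (tent (a i) r))
  have hint : Integrable (tent (a i) r) (μ : Measure X) :=
    (BoundedContinuousFunction.mkOfCompact (tent (a i) r)).integrable _
  have hle : (μ : Measure X).real {a i} ≤ ∫ x, tent (a i) r x ∂(μ : Measure X) := by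
    simpa [integral_singleton, tent_self, measureReal_def] using
      setIntegral_le_integral (s := {a i}) hint (.of_forall (tent_nonneg (a i) r))
  exact hcont.continuousAt.eventually_const_le ((sub_lt_self _ hη).trans_le hle)

end FinitelySupported

theorem exists_pos_forall_sub_le_measureReal_ball_imp_mem {X I : Type*} [MetricSpace X]
    [MeasurableSpace X] [OpensMeasurableSpace X] [Finite I] {a : I → X}
    (ha : Function.Injective a) {μ : ProbabilityMeasure X} (hμ : (μ : Measure X) (Set.range a)ᶜ = 0)
    {U : Set (ProbabilityMeasure X)} (hU : U ∈ 𝓝 μ) :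
    ∃ r > 0, Pairwise (Function.onFun Disjoint fun i => Metric.ball (a i) r) ∧
      ∀ ν : ProbabilityMeasure X,
        (∀ i, (μ : Measure X).real {a i} - r ≤ (ν : Measure X).real (Metric.ball (a i) r)) →
          ν ∈ U := by
  have := Fintype.ofFinite I
  obtain ⟨δ, hδ, hδU⟩ := Metric.nhds_basis_closedBall.mem_iff.1
    (LevyProkhorov.continuous_toMeasure_probabilityMeasure.tendsto (.ofMeasure μ) hU)
  obtain ⟨ρ, hρ, hdisj⟩ := (pairwise_disjoint_nhds.comp_of_injective
    ha).exists_mem_filter_basis_of_disjoint fun i => Metric.nhds_basis_ball (x := a i)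
  have hsmall : ∀ᶠ r : ℝ in 𝓝 0, (∀ i, r ≤ ρ i) ∧ r ≤ δ ∧ Fintype.card I * r ≤ δ := by
    have hcard : Tendsto (fun r : ℝ => Fintype.card I * r) (𝓝 0) (𝓝 0) :=
      Continuous.tendsto' (by fun_prop) _ _ (mul_zero _)
    exact (eventually_all.2 fun i => eventually_le_nhds (hρ i)).and
      ((eventually_le_nhds hδ).and (hcard.eventually_le_const hδ))
  obtain ⟨r, ⟨hrρ, hrδ, hcard⟩, hr⟩ :=
    ((hsmall.filter_mono (nhdsWithin_le_nhds (s := Set.Ioi 0))).and self_mem_nhdsWithin).exists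
  have hrdisj : Pairwise (Function.onFun Disjoint fun i => Metric.ball (a i) r) := fun i j hij =>
    (hdisj hij).mono (Metric.ball_subset_ball (hrρ i)) (Metric.ball_subset_ball (hrρ j))
  refine ⟨r, hr, hrdisj, fun ν hν => ?_⟩
  have hdist := levyProkhorovDist_le_of_forall_sub_le_measureReal_ball hμ hr.le hrδ hcard hrdisj hν
  exact @hδU (.ofMeasure ν) (by rwa [Metric.mem_closedBall, dist_comm])

theorem sum_measureReal_singleton_support {X : Type*} [TopologicalSpace X]
    [HereditarilyLindelofSpace X] [MeasurableSpace X] [MeasurableSingletonClass X] (μ : Measure X)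
    [IsProbabilityMeasure μ] [Fintype μ.support] : ∑ l : μ.support, μ.real {l.1} = 1 := by
  rw [Finset.sum_set_coe (f := fun x => μ.real {x}), sum_measureReal_singleton, Set.coe_toFinset,
    ← probReal_univ (μ := μ)]
  exact measureReal_congr (eventuallyEq_univ.2 (mem_ae_iff.2 Measure.measure_compl_support))

theorem exists_pos_forall_mul_le {J : Type*} [Finite J] {r : J → ℝ} (hr : ∀ j, 0 < r j) (C : ℝ) :
    ∃ η > 0, ∀ j, η * C ≤ r j := by
  have hlim : Tendsto (fun η : ℝ => η * C) (𝓝[>] 0) (𝓝 0) :=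
    tendsto_nhdsWithin_of_tendsto_nhds (Continuous.tendsto' (by fun_prop) _ _ (zero_mul C))
  exact (eventually_mem_nhdsWithin.and
    (eventually_all.2 fun j => hlim.eventually_le_const (hr j))).exists

section IndependenceSets

variable {Γ Y ι : Type*} [SMul Γ Y] {k : ℕ} {A B : Fin k → Set Y} {F : Set Γ}

theorem IsIndependenceSet.mono (hF : IsIndependenceSet A F) (hAB : ∀ j, A j ⊆ B j) :
    IsIndependenceSet B F := fun J hJ hJF σ =>
  (hF J hJ hJF σ).mono (Set.iInter_mono fun s => Set.preimage_mono (hAB (σ s)))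

theorem IsIndependenceSet.subset {F' : Set Γ} (hF : IsIndependenceSet A F) (hF' : F' ⊆ F) :
    IsIndependenceSet A F' := fun J hJ hJF => hF J hJ (hJF.trans hF')

variable [NeZero k]

theorem isIndependenceSet_iff : IsIndependenceSet A F ↔ ∀ J : Finset Γ, J.Nonempty →
    (J : Set Γ) ⊆ F → ∀ σ : Γ → Fin k, ∃ y : Y, ∀ s ∈ J, s • y ∈ A (σ s) := by
  refine forall₃_congr fun J _ _ => ?_
  rw [Subtype.val_injective.surjective_comp_right.forall]
  simp [Set.Nonempty]

theorem isIndependenceSet_image_iff (e : ι ↪ Γ) {H : Set ι} :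
    IsIndependenceSet A (e '' H) ↔ ∀ J : Finset ι, J.Nonempty → (J : Set ι) ⊆ H →
      ∀ σ : ι → Fin k, ∃ y : Y, ∀ s ∈ J, e s • y ∈ A (σ s) := by
  classical
  rw [isIndependenceSet_iff]
  refine ⟨fun h J hJ hJH => e.injective.surjective_comp_right.forall.2 fun σ => ?_,
    fun h J hJ hJH σ => ?_⟩
  · simpa using h (J.map e) hJ.map (by simpa using Set.image_mono hJH) σ
  · obtain ⟨J, hJH', rfl⟩ := Finset.subset_set_image_iff.1 hJH
    simpa using h J hJ.of_image hJH' (σ ∘ e)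

end IndependenceSets

section FiniteSupportIndependence

variable {Γ X : Type*} [Group Γ] [TopologicalSpace X] [MeasurableSpace X] [BorelSpace X]
  [MulAction Γ X] [ContinuousConstSMul Γ X]

theorem integral_smul_probabilityMeasure (g : Γ) (ν : ProbabilityMeasure X) {f : X → ℝ}
    (hf : StronglyMeasurable f) :
    ∫ x, f x ∂((g • ν : ProbabilityMeasure X) : Measure X) = ∫ x, f (g • x) ∂(ν : Measure X) := by
  rw [coe_smul_probabilityMeasure,
    integral_map (measurable_const_smul g).aemeasurable hf.aestronglyMeasurable]

theorem measureReal_smul_probabilityMeasure (g : Γ) (ν : ProbabilityMeasure X) {s : Set X}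
    (hs : MeasurableSet s) : ((g • ν : ProbabilityMeasure X) : Measure X).real s =
      (ν : Measure X).real ((fun x => g • x) ⁻¹' s) := by
  rw [coe_smul_probabilityMeasure, map_measureReal_apply (measurable_const_smul g) hs]

variable [CompactSpace X] [TopologicalSpace.MetrizableSpace X] {k : ℕ} [NeZero k]
  {L : Fin k → Type*} [∀ j, Fintype (L j)] [∀ j, Nonempty (L j)]

theorem IsIndependenceSet.exists_infinite_finSuppMeasures {φ : ∀ j, L j → C(X, ℝ)}
    (h0 : ∀ j l x, 0 ≤ φ j l x) (h1 : ∀ j x, ∑ l, φ j l x ≤ 1) {c : ∀ j, L j → ℝ} {F : Set Γ}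
    (hF : IsIndependenceSet
      (fun j => {ν : ProbabilityMeasure X | ∀ l, c j l ≤ ∫ x, φ j l x ∂(ν : Measure X)}) F)
    (hFinf : F.Infinite) {N : ℕ} (hN : ∏ j, Fintype.card (L j) ≤ N) :
    ∃ H : Set Γ, H.Infinite ∧ IsIndependenceSet
      (fun j => {ν : finSuppMeasures X N | ∀ l, c j l - ∑ j', (1 - ∑ l', c j' l') ≤
        (ν : Measure X).real {x | 0 < φ j l x}}) H := by
  let e : ℕ ↪ Γ := hFinf.natEmbedding.trans (.subtype _)
  have he : e '' Set.univ ⊆ F := Set.image_subset_iff.2 fun n _ => (hFinf.natEmbedding F n).2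
  have hFe := (isIndependenceSet_image_iff e).1 (hF.subset he)
  obtain ⟨H, hH, hHind⟩ := exists_infinite_forall_finset_exists_probabilityMeasure
    (φ := fun n j l => (φ j l).comp ⟨fun x => e n • x, continuous_const_smul _⟩)
    (fun n j l x => h0 j l _) (fun n j x => h1 j _) (c := c) fun J σ => by
      obtain ⟨ν, hν⟩ := hFe (insert 0 J) (J.insert_nonempty 0) (Set.subset_univ _) σ
      refine ⟨ν, fun n hn l => (hν n (Finset.mem_insert_of_mem hn) l).trans_eq ?_⟩
      exact integral_smul_probabilityMeasure (e n) ν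
        (φ (σ n) l).continuous.measurable.stronglyMeasurable
  refine ⟨e '' H, hH.image e.injective.injOn, (isIndependenceSet_image_iff e).2 ?_⟩
  intro J _ hJ σ
  obtain ⟨ν, hcard, hν⟩ := hHind J hJ σ
  refine ⟨⟨ν, hcard.trans ?_⟩, fun n hn l => (hν n hn l).trans_eq ?_⟩
  · rw [Fintype.card_pi]
    exact_mod_cast hN
  · exact (measureReal_smul_probabilityMeasure (e n) ν
      (isOpen_lt continuous_const (φ (σ n) l).continuous).measurableSet).symm

theorem exists_infinite_isIndependenceSet_finSuppMeasures_of_mem_ITTuples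
    {μ : Fin k → ProbabilityMeasure X} (hμ : μ ∈ ITTuples Γ (ProbabilityMeasure X) k)
    (hfin : ∀ j, (μ j : Measure X).support.Finite) {N : ℕ}
    (hN : ∏ j, (μ j : Measure X).support.ncard ≤ N) {V : Fin k → Set (ProbabilityMeasure X)}
    (hV : ∀ j, V j ∈ 𝓝 (μ j)) :
    ∃ H : Set Γ, H.Infinite ∧
      IsIndependenceSet
        (fun j => ((↑) : finSuppMeasures X N → ProbabilityMeasure X) ⁻¹' V j) H := by
  let := TopologicalSpace.metrizableSpaceMetric X
  have := fun j => (hfin j).fintype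
  have := fun j => (Measure.nonempty_support (NeZero.ne (μ j : Measure X))).to_subtype
  let a : ∀ j, (μ j : Measure X).support → X := fun _ => Subtype.val
  choose r hr hdisj hrV using fun j => exists_pos_forall_sub_le_measureReal_ball_imp_mem
    (a := a j) Subtype.val_injective (by simp [a]) (hV j)
  let m : ℝ := ∑ j, Fintype.card (μ j : Measure X).support
  obtain ⟨η, hη, hηr⟩ := exists_pos_forall_mul_le hr (1 + m)
  obtain ⟨F, hF, hFind⟩ := hμ _ fun j =>
    setOf_forall_sub_le_integral_tent_mem_nhds (a := a j) (r := r j) (μ j) hη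
  obtain ⟨H, hH, hHind⟩ := IsIndependenceSet.exists_infinite_finSuppMeasures
    (φ := fun j l => tent (a j l) (r j)) (fun j l => tent_nonneg _ _)
    (fun j => sum_tent_le_one (hr j) (hdisj j)) hFind hF
    (by simpa only [Set.fintypeCard_eq_ncard] using hN)
  have hloss : ∑ j, (1 - ∑ l, ((μ j : Measure X).real {a j l} - η)) = m * η := by
    simp only [a, m, Finset.sum_sub_distrib, sum_measureReal_singleton_support, Finset.sum_const,
      sub_sub_cancel, Finset.card_univ, nsmul_eq_mul, ← Finset.sum_mul]
  refine ⟨H, hH, hHind.mono fun j ν hν => hrV j _ fun l => ?_⟩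
  have hνl := hν l
  simp only [tent_pos_iff (hr j), hloss] at hνl
  exact le_trans (by linarith [hηr j]) hνl

end FiniteSupportIndependence

theorem mainTheorem10_general {Γ X : Type*} [Group Γ]
    [TopologicalSpace X] [CompactSpace X] [TopologicalSpace.MetrizableSpace X]
    [MeasurableSpace X] [BorelSpace X] [MulAction Γ X] [ContinuousConstSMul Γ X]
    (k : ℕ) (hk : 1 ≤ k) (N : Fin k → ℕ) (hN : ∀ j, 1 ≤ N j) :
    (Set.univ.pi fun j => finSuppMeasures X (N j)) ∩ ITTuples Γ (ProbabilityMeasure X) k ⊆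
      (fun (ν : Fin k → finSuppMeasures X (∏ j, N j)) (j : Fin k) =>
        (ν j : ProbabilityMeasure X)) '' ITTuples Γ (finSuppMeasures X (∏ j, N j)) k := by
  rintro μ ⟨hμN, hIT⟩
  have : NeZero k := ⟨Nat.one_le_iff_ne_zero.1 hk⟩
  have hμN : ∀ j, (μ j : Measure X).support.encard ≤ N j := fun j => hμN j trivial
  have hNprod : ∀ j, N j ≤ ∏ j, N j := fun j =>
    Nat.le_of_dvd (Finset.prod_pos fun j _ => hN j) (Finset.dvd_prod_of_mem N (Finset.mem_univ j))
  have hcard : ∏ j, (μ j : Measure X).support.ncard ≤ ∏ j, N j :=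
    Finset.prod_le_prod' fun j _ => ENat.toNat_le_of_le_natCast (hμN j)
  refine ⟨fun j => ⟨μ j, (hμN j).trans (by exact_mod_cast hNprod j)⟩, fun U hU => ?_, rfl⟩
  choose V hV hVU using fun j => (mem_nhds_subtype _ _ _).1 (hU j)
  obtain ⟨H, hH, hHind⟩ := exists_infinite_isIndependenceSet_finSuppMeasures_of_mem_ITTuples hIT
    (fun j => Set.finite_of_encard_le_coe (hμN j)) hcard hV
  exact ⟨H, hH, hHind.mono hVU⟩

theorem mainTheorem10 {Γ X : Type*} [Group Γ] [Countable Γ] [Infinite Γ]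
    [TopologicalSpace X] [CompactSpace X] [TopologicalSpace.MetrizableSpace X]
    [MeasurableSpace X] [BorelSpace X] [MulAction Γ X] [ContinuousConstSMul Γ X]
    (k : ℕ) (hk : 1 ≤ k) (N : Fin k → ℕ) (hN : ∀ j, 1 ≤ N j) :
    (Set.univ.pi fun j => finSuppMeasures X (N j)) ∩ ITTuples Γ (ProbabilityMeasure X) k ⊆
      (fun (ν : Fin k → finSuppMeasures X (∏ j, N j)) (j : Fin k) =>
        (ν j : ProbabilityMeasure X)) '' ITTuples Γ (finSuppMeasures X (∏ j, N j)) k :=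
  mainTheorem10_general k hk N hN
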